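/- Call $w:\mathbb R\to[0,\infty)$ a weight if $\int |x|^k w(x)\,dx<\infty$ for all $k\ge 0$. Let $\vec w_1=(w_{1,1},\dots,w_{1,p})$ and $\vec w_2=(w_{2,1},\dots,w_{2,q})$ be vectors of weights and let $\vec n=(n_1,\dots,n_p)$, $\vec m=(m_1,\dots,m_q)$ be multi-indices of positive integers with $|\vec n|=|\vec m|=N$, where $|\vec n|=\sum_j n_j$. Put $$F_{\vec n}=\Big\{\sum_{j=1}^p A_jw_{1,j}: A_j\in\mathbb R[x],\ \deg A_j\le n_j-1\Big\},\qquad G_{\vec m}=\Big\{\sum_{k=1}^q B_kw_{2,k}: B_k\in\mathbb R[x],\ \deg B_k\le m_k-1\Big\}.$$ Assume that $F_{\vec n}$ and $G_{\vec m}$ are $N$-dimensional subspaces of $L^2(\mathbb R)$ with $F_{\vec n}\cap G_{\vec m}^{\perp}=\{0\}$, and that $x^{n_j+m_k-1}w_{1,j}(x)w_{2,k}(x)$ is integrable on $\mathbb R$ for all $j,k$. For multi-indices $\vec\nu,\vec\mu$ of lengths $p,q$ with $|\vec\nu|=|\vec\mu|+1$, polynomials $A_1,\dots,A_p$ with $\deg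 A_j\le\nu_j-1$ are called multiple orthogonal polynomials of mixed type for $(\vec\nu,\vec\mu)$ with respect to $\vec w_1,\vec w_2$ if $Q=\sum_{j}A_jw_{1,j}$ satisfies $\int Q(x)x^iw_{2,k}(x)\,dx=0$ (with convergent integrals) for $0\le i\le\mu_k-1$, $k=1,\dots,q$. The pair $(\vec\nu,\vec\mu)$ is normal if there is a non-zero such tuple and it is unique up to a multiplicative constant. Write $Q=Q^{(I,k)}_{\vec\nu,\vec\mu}(\,\cdot\,;\vec w_1,\vec w_2)$ if the normalization is $\int Q(x)x^{\mu_k}w_{2,k}(x)\,dx=1$, and $Q=Q^{(II,k)}_{\vec\nu,\vec\mu}(\,\cdot\,;\vec w_1,\vec w_2)$ if it is that $A_k$ is monic of degree $\nu_k-1$. The notation with $(\vec w_2,\vec w_1)$ means that the roles of the two vectors of weights (and $p,q$) are interchanged. Let $\vec e_j$ be the $j$-th standard multi-index. Then the pairs of multi-indices occurring in the formula below are normal, the polynomials with the normalizations indicated there exist and are unique, and there are biorthogonal bases $\phi_1,\dots,\phi_N$ of $F_{\vec n}$ and $\psi_1,\dots,\psi_N$ of $G_{\vec m}$, that is, bases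 with $\int\phi_i\psi_j\,dx=\delta_{ij}$. For any such bases the kernel $K(x,y)=\sum_{i=1}^N\phi_i(x)\psi_i(y)$ satisfies, for all $x,y\in\mathbb R$, $$(x-y)K(x,y)=\sum_{j=1}^{p}Q^{(II,j)}_{\vec n+\vec e_j,\vec m}(x;\vec w_1,\vec w_2)\,Q^{(I,j)}_{\vec m,\vec n-\vec e_j}(y;\vec w_2,\vec w_1)-\sum_{k=1}^{q}Q^{(I,k)}_{\vec n,\vec m-\vec e_k}(x;\vec w_1,\vec w_2)\,Q^{(II,k)}_{\vec m+\vec e_k,\vec n}(y;\vec w_2,\vec w_1).$$ -/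

import Mathlib

open MeasureTheory Polynomial

namespace MixedMOP

noncomputable section

/-- A weight on the real line: a non-negative function all of whose moments are finite. -/
structure IsWeight (w : ℝ → ℝ) : Prop where
  nonneg : ∀ x, 0 ≤ w x
  integrable_moment : ∀ k : ℕ, Integrable (fun x : ℝ => x ^ k * w x)

/-- The linear form `x ↦ ∑ j, A j (x) * w j (x)` of a tuple of polynomials `A` with respect to
a vector of weights `w`. -/
def linearForm {p : ℕ} (w : Fin p → ℝ → ℝ) (A : Fin p → ℝ[X]) : ℝ → ℝ :=
  fun x => ∑ j, (A j).eval x * w j x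

/-- The space `F_n` of all linear forms `∑ j, A j * w j` with `deg (A j) ≤ n j - 1`
(so `A j = 0` if `n j = 0`), as a space of functions defined at every point of `ℝ`. -/
def formSpace {p : ℕ} (w : Fin p → ℝ → ℝ) (n : Fin p → ℕ) : Submodule ℝ (ℝ → ℝ) where
  carrier := {f | ∃ A : Fin p → ℝ[X], (∀ j, (A j).degree < n j) ∧ f = linearForm w A}
  zero_mem' := ⟨0, fun j => by simp, by ext x; simp [linearForm]⟩
  add_mem' := by
    rintro _ _ ⟨A, hA, rfl⟩ ⟨B, hB, rfl⟩
    refine ⟨A + B, fun j => (degree_add_le _ _).trans_lt (max_lt (hA j) (hB j)), ?_⟩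
    ext x
    simp [linearForm, add_mul, Finset.sum_add_distrib]
  smul_mem' := by
    rintro c _ ⟨A, hA, rfl⟩
    refine ⟨c • A, fun j => (degree_smul_le c (A j)).trans_lt (hA j), ?_⟩
    ext x
    simp [linearForm, Finset.mul_sum, mul_assoc]

/-- The subspace of `L²(ℝ)` formed by the classes of those functions in `F` that are square
integrable. -/
def toL2 (F : Submodule ℝ (ℝ → ℝ)) : Submodule ℝ (Lp ℝ 2 (volume : Measure ℝ)) where
  carrier := {u | ∃ f ∈ F, (u : ℝ → ℝ) =ᵐ[volume] f}
  zero_mem' := ⟨0, F.zero_mem, Lp.coeFn_zero _ _ _⟩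
  add_mem' := by
    rintro u v ⟨f, hf, huf⟩ ⟨g, hg, hvg⟩
    exact ⟨f + g, F.add_mem hf hg, (Lp.coeFn_add u v).trans (huf.add hvg)⟩
  smul_mem' := by
    rintro c u ⟨f, hf, huf⟩
    exact ⟨c • f, F.smul_mem c hf, (Lp.coeFn_smul c u).trans (huf.const_smul c)⟩

/-- `A` is a tuple of multiple orthogonal polynomials of mixed type for the pair of multi-indices
`(n, m)` with respect to the vectors of weights `w₁`, `w₂`. -/
structure IsMixedMOP {p q : ℕ} (w₁ : Fin p → ℝ → ℝ) (w₂ : Fin q → ℝ → ℝ)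
    (n : Fin p → ℕ) (m : Fin q → ℕ) (A : Fin p → ℝ[X]) : Prop where
  card_eq : (∑ j, n j) = (∑ k, m k) + 1
  degree_lt : ∀ j, (A j).degree < n j
  integrable : ∀ k, ∀ i < m k, Integrable (fun x : ℝ => linearForm w₁ A x * x ^ i * w₂ k x)
  integral_eq_zero : ∀ k, ∀ i < m k, ∫ x : ℝ, linearForm w₁ A x * x ^ i * w₂ k x = 0

/-- The pair `(n, m)` is normal: up to a multiplicative constant there is exactly one non-zero
tuple of multiple orthogonal polynomials of mixed type. -/
def IsNormalPair {p q : ℕ} (w₁ : Fin p → ℝ → ℝ) (w₂ : Fin q → ℝ → ℝ)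
    (n : Fin p → ℕ) (m : Fin q → ℕ) : Prop :=
  ∃ A, A ≠ 0 ∧ IsMixedMOP w₁ w₂ n m A ∧
    ∀ B, IsMixedMOP w₁ w₂ n m B → ∃ c : ℝ, B = c • A

/-- Type I normalization with respect to the `k`-th index of `m`. -/
structure IsTypeI {p q : ℕ} (w₁ : Fin p → ℝ → ℝ) (w₂ : Fin q → ℝ → ℝ)
    (n : Fin p → ℕ) (m : Fin q → ℕ) (k : Fin q) (A : Fin p → ℝ[X]) : Prop
    extends IsMixedMOP w₁ w₂ n m A where
  integral_eq_one : ∫ x : ℝ, linearForm w₁ A x * x ^ m k * w₂ k x = 1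

/-- Type II normalization with respect to the `k`-th index of `n`: the polynomial `A k` is monic
of degree `n k - 1`. -/
structure IsTypeII {p q : ℕ} (w₁ : Fin p → ℝ → ℝ) (w₂ : Fin q → ℝ → ℝ)
    (n : Fin p → ℕ) (m : Fin q → ℕ) (k : Fin p) (A : Fin p → ℝ[X]) : Prop
    extends IsMixedMOP w₁ w₂ n m A where
  monic : (A k).Monic
  natDegree_add_one : (A k).natDegree + 1 = n k

open Classical in
/-- The polynomials `A^{(I,k)}_{n,m}(· ; w₁, w₂)` (`0` if there are none). -/
def polyI {p q : ℕ} (w₁ : Fin p → ℝ → ℝ) (w₂ : Fin q → ℝ → ℝ)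
    (n : Fin p → ℕ) (m : Fin q → ℕ) (k : Fin q) : Fin p → ℝ[X] :=
  if h : ∃ A, IsTypeI w₁ w₂ n m k A then h.choose else 0

open Classical in
/-- The polynomials `A^{(II,k)}_{n,m}(· ; w₁, w₂)` (`0` if there are none). -/
def polyII {p q : ℕ} (w₁ : Fin p → ℝ → ℝ) (w₂ : Fin q → ℝ → ℝ)
    (n : Fin p → ℕ) (m : Fin q → ℕ) (k : Fin p) : Fin p → ℝ[X] :=
  if h : ∃ A, IsTypeII w₁ w₂ n m k A then h.choose else 0

/-- The linear form `Q^{(I,k)}_{n,m}(· ; w₁, w₂)`. -/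
def QI {p q : ℕ} (w₁ : Fin p → ℝ → ℝ) (w₂ : Fin q → ℝ → ℝ)
    (n : Fin p → ℕ) (m : Fin q → ℕ) (k : Fin q) : ℝ → ℝ :=
  linearForm w₁ (polyI w₁ w₂ n m k)

/-- The linear form `Q^{(II,k)}_{n,m}(· ; w₁, w₂)`. -/
def QII {p q : ℕ} (w₁ : Fin p → ℝ → ℝ) (w₂ : Fin q → ℝ → ℝ)
    (n : Fin p → ℕ) (m : Fin q → ℕ) (k : Fin p) : ℝ → ℝ :=
  linearForm w₁ (polyII w₁ w₂ n m k)

/-- The standard multi-index `e_k`. -/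
def e {p : ℕ} (k : Fin p) : Fin p → ℕ := Pi.single k 1

/-- Biorthogonality of a basis of `F` and a basis of `G`. -/
def Biorthogonal {N : ℕ} {F G : Submodule ℝ (ℝ → ℝ)}
    (φ : Module.Basis (Fin N) ℝ F) (ψ : Module.Basis (Fin N) ℝ G) : Prop :=
  ∀ i j, ∫ x : ℝ, (φ i : ℝ → ℝ) x * (ψ j : ℝ → ℝ) x = if i = j then 1 else 0

/-- The kernel `K(x, y) = ∑ i, φ i (x) * ψ i (y)`. -/
def kernel {N : ℕ} {F G : Submodule ℝ (ℝ → ℝ)}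
    (φ : Module.Basis (Fin N) ℝ F) (ψ : Module.Basis (Fin N) ℝ G) (x y : ℝ) : ℝ :=
  ∑ i, (φ i : ℝ → ℝ) x * (ψ i : ℝ → ℝ) y

end

end MixedMOP

open MeasureTheory Polynomial

namespace MixedMOP

variable {p q : ℕ} {w₁ : Fin p → ℝ → ℝ} {w₂ : Fin q → ℝ → ℝ} {n : Fin p → ℕ} {m : Fin q → ℕ}

/-! Write ⟨f, g⟩ = ∫ f g. Multiplication by x almost preserves F: if f comes from the tuple A, then
x f leaves F only through the coefficients of x^(n_j) in x A_j, and subtracting c_j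
Q^(II,j)_(n+e_j,m) with c_j = (A_j).coeff (n_j - 1) brings it back. Type II forms are orthogonal to
G, so the remainder f' satisfies ⟨f', g⟩ = ⟨x f, g⟩ on G. Moreover c_j = ⟨f, Q^(I,j)_(m,n-e_j)⟩.
This is `exists_mul_X_eq`.

Apply it to each φ_i, multiply by ψ_i(y) and sum: since Q^(I,j) = ∑ ⟨φ_i, Q^(I,j)⟩ ψ_i, the
coefficients recombine into the first sum of the formula. The same argument for y ψ_i gives the
second sum. Both remainders equal ∑_{i,l} ⟨t φ_i, ψ_l⟩ φ_l(x) ψ_i(y) and cancel.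

Existence, uniqueness and normality all come from the non-singularity of the square matrix of mixed
moments, isolated in `Admissible`: arbitrary moments can be prescribed (`exists_moments`), and the
condition is symmetric in the two vectors of weights (`Admissible.symm`). The L² hypotheses enter
only through `admissible_of_toL2`. -/

/-- Linear forms as a linear map in the tuple of polynomials. -/
noncomputable def linearFormHom (w : Fin p → ℝ → ℝ) : (Fin p → ℝ[X]) →ₗ[ℝ] (ℝ → ℝ) where
  toFun := linearForm w
  map_add' A B := by
    ext x
    simp [linearForm, add_mul, Finset.sum_add_distrib]
  map_smul' c A := by
    ext x
    simp [linearForm, Finset.mul_sum, mul_assoc]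

@[simp]
lemma linearFormHom_apply (w : Fin p → ℝ → ℝ) (A : Fin p → ℝ[X]) :
    linearFormHom w A = linearForm w A := rfl

lemma linearForm_eq_sum (w : Fin p → ℝ → ℝ) {a : Fin p → ℕ} {A : Fin p → ℝ[X]}
    (hA : ∀ j, (A j).degree < a j) (x : ℝ) :
    linearForm w A x = ∑ j, ∑ s ∈ Finset.range (a j), (A j).coeff s * (x ^ s * w j x) := by
  unfold linearForm
  refine Finset.sum_congr rfl fun j _ => ?_
  have h : (A j).eval x = ∑ s ∈ Finset.range (a j), (A j).coeff s * x ^ s := by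
    by_cases h0 : A j = 0
    · simp [h0]
    · exact eval_eq_sum_range' ((natDegree_lt_iff_degree_lt h0).2 (hA j)) x
  rw [h, Finset.sum_mul]
  exact Finset.sum_congr rfl fun s _ => by ring

lemma linearForm_single (w : Fin p → ℝ → ℝ) (j : Fin p) (P : ℝ[X]) (x : ℝ) :
    linearForm w (Pi.single j P) x = P.eval x * w j x := by
  unfold linearForm
  rw [Finset.sum_eq_single j]
  · simp
  · intro l _ hl
    simp [Pi.single_eq_of_ne hl]
  · simp

lemma degree_single_X_pow_lt {a : Fin p → ℕ} {j : Fin p} {s : ℕ} (hs : s < a j) (l : Fin p) :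
    ((Pi.single j (X ^ s) : Fin p → ℝ[X]) l).degree < a l := by
  by_cases h : l = j
  · subst h
    simpa using hs
  · simp [Pi.single_eq_of_ne h]

lemma linearForm_mem (w : Fin p → ℝ → ℝ) {A : Fin p → ℝ[X]} (hA : ∀ j, (A j).degree < n j) :
    linearForm w A ∈ formSpace w n := ⟨A, hA, rfl⟩

/-! ### Integrability and moments under the admissibility hypothesis. -/

/-- The hypotheses on the weights and multi-indices in terms of moments: the moments exist up to
the required order, and the (square) matrix of mixed moments is non-singular. -/
structure Admissible (w₁ : Fin p → ℝ → ℝ) (w₂ : Fin q → ℝ → ℝ) (n : Fin p → ℕ)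
    (m : Fin q → ℕ) : Prop where
  card_eq : ∑ j, n j = ∑ k, m k
  integrable : ∀ j k a, a < n j + m k → Integrable fun x : ℝ => x ^ a * (w₁ j x * w₂ k x)
  eq_zero : ∀ A : Fin p → ℝ[X], (∀ j, (A j).degree < n j) →
    (∀ k, ∀ i < m k, ∫ x : ℝ, linearForm w₁ A x * x ^ i * w₂ k x = 0) → A = 0

namespace Admissible

/-- The highest power in the product is (a_j - 1) + (b_k - 1); the slack of 1 in `hab` lets one
factor be a type II form or a multiple by x. -/
lemma integrable_mul (H : Admissible w₁ w₂ n m) {a : Fin p → ℕ} {b : Fin q → ℕ}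
    (hab : ∀ j k, a j + b k ≤ n j + m k + 1) {A : Fin p → ℝ[X]} {B : Fin q → ℝ[X]}
    (hA : ∀ j, (A j).degree < a j) (hB : ∀ k, (B k).degree < b k) :
    Integrable fun x : ℝ => linearForm w₁ A x * linearForm w₂ B x := by
  simp_rw [linearForm_eq_sum w₁ hA, linearForm_eq_sum w₂ hB, Finset.sum_mul_sum]
  refine integrable_finsetSum _ fun j _ => integrable_finsetSum _ fun k _ =>
    integrable_finsetSum _ fun s hs => integrable_finsetSum _ fun t ht => ?_
  have hs' := Finset.mem_range.1 hs
  have ht' := Finset.mem_range.1 ht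
  have := hab j k
  refine ((H.integrable j k (s + t) (by omega)).const_mul
    ((A j).coeff s * (B k).coeff t)).congr (.of_forall fun x => ?_)
  simp only [pow_add]
  ring

lemma integrable_moment (H : Admissible w₁ w₂ n m) {a : Fin p → ℕ} (k : Fin q) {i : ℕ}
    (hi : ∀ j, a j + i ≤ n j + m k) {A : Fin p → ℝ[X]} (hA : ∀ j, (A j).degree < a j) :
    Integrable fun x : ℝ => linearForm w₁ A x * x ^ i * w₂ k x := by
  simp_rw [mul_assoc, linearForm_eq_sum w₁ hA, Finset.sum_mul]
  refine integrable_finsetSum _ fun j _ => integrable_finsetSum _ fun s hs => ?_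
  have hs' := Finset.mem_range.1 hs
  have := hi j
  refine ((H.integrable j k (s + i) (by omega)).const_mul
    ((A j).coeff s)).congr (.of_forall fun x => ?_)
  simp only [pow_add]
  ring

lemma integral_mul_eq (H : Admissible w₁ w₂ n m) {a : Fin p → ℕ} (ha : ∀ j, a j ≤ n j + 1)
    {A : Fin p → ℝ[X]} {B : Fin q → ℝ[X]}
    (hA : ∀ j, (A j).degree < a j) (hB : ∀ k, (B k).degree < m k) :
    ∫ x : ℝ, linearForm w₁ A x * linearForm w₂ B x = ∑ k, ∑ i ∈ Finset.range (m k),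
      (B k).coeff i * ∫ x : ℝ, linearForm w₁ A x * x ^ i * w₂ k x := by
  have hint : ∀ k, ∀ i ∈ Finset.range (m k),
      Integrable fun x : ℝ => (B k).coeff i * (linearForm w₁ A x * x ^ i * w₂ k x) :=
    fun k i hi => (H.integrable_moment k (fun j => by
      have := Finset.mem_range.1 hi
      have := ha j
      omega) hA).const_mul _
  have h : ∀ x, linearForm w₁ A x * linearForm w₂ B x = ∑ k, ∑ i ∈ Finset.range (m k),
      (B k).coeff i * (linearForm w₁ A x * x ^ i * w₂ k x) := fun x => by
    rw [linearForm_eq_sum w₂ hB, Finset.mul_sum]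
    refine Finset.sum_congr rfl fun k _ => ?_
    rw [Finset.mul_sum]
    exact Finset.sum_congr rfl fun i _ => by ring
  simp_rw [h]
  rw [integral_finsetSum _ fun k _ => integrable_finsetSum _ (hint k)]
  refine Finset.sum_congr rfl fun k _ => ?_
  rw [integral_finsetSum _ (hint k)]
  simp_rw [integral_const_mul]

lemma moment_sub_smul (H : Admissible w₁ w₂ n m) {a : Fin p → ℕ} (k : Fin q) {i : ℕ}
    (hi : ∀ j, a j + i ≤ n j + m k) {A B : Fin p → ℝ[X]} (hA : ∀ j, (A j).degree < a j)
    (hB : ∀ j, (B j).degree < a j) (c : ℝ) :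
    ∫ x : ℝ, linearForm w₁ (A - c • B) x * x ^ i * w₂ k x =
      (∫ x : ℝ, linearForm w₁ A x * x ^ i * w₂ k x) -
        c * ∫ x : ℝ, linearForm w₁ B x * x ^ i * w₂ k x := by
  rw [← integral_const_mul, ← integral_sub (H.integrable_moment k hi hA)
    ((H.integrable_moment k hi hB).const_mul c)]
  refine integral_congr_ae (.of_forall fun x => ?_)
  simp only [← linearFormHom_apply, map_sub, map_smul]
  simp
  ring

end Admissible

lemma degree_sub_smul_lt {a : Fin p → ℕ} {A B : Fin p → ℝ[X]} (hA : ∀ j, (A j).degree < a j)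
    (hB : ∀ j, (B j).degree < a j) (c : ℝ) (j : Fin p) : ((A - c • B) j).degree < a j :=
  (degree_sub_le _ _).trans_lt (max_lt (hA j) ((degree_smul_le c (B j)).trans_lt (hB j)))

instance (n : ℕ) : Module.Finite ℝ (degreeLT ℝ n) :=
  Module.Finite.equiv (degreeLTEquiv ℝ n).symm

lemma finrank_pi_degreeLT (n : Fin p → ℕ) :
    Module.finrank ℝ (∀ j, degreeLT ℝ (n j)) = ∑ j, n j := by
  rw [Module.finrank_pi_fintype]
  exact Finset.sum_congr rfl fun j _ => by
    rw [(degreeLTEquiv ℝ (n j)).finrank_eq, Module.finrank_fin_fun]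

/-! ### The moment problem and its symmetry. -/

namespace Admissible

/-- The moment map is linear and injective between spaces of equal dimension ∑ n_j = ∑ m_k, hence
surjective. -/
lemma exists_moments (H : Admissible w₁ w₂ n m) (c : Fin q → ℕ → ℝ) :
    ∃ A : Fin p → ℝ[X], (∀ j, (A j).degree < n j) ∧
      ∀ k, ∀ i < m k, ∫ x : ℝ, linearForm w₁ A x * x ^ i * w₂ k x = c k i := by
  have hdeg (A : ∀ j, degreeLT ℝ (n j)) (j : Fin p) : (A j : ℝ[X]).degree < n j :=
    mem_degreeLT.1 (A j).2
  let T : (∀ j, degreeLT ℝ (n j)) →ₗ[ℝ] (∀ k, Fin (m k) → ℝ) :=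
    { toFun := fun A k i => ∫ x : ℝ, linearForm w₁ (fun j => (A j : ℝ[X])) x * x ^ (i : ℕ) * w₂ k x
      map_add' := fun A B => by
        ext k i
        have hi : ∀ j, n j + (i : ℕ) ≤ n j + m k := fun j => by omega
        -- Additivity is the case c = -1; homogeneity below is the case of 0 - (-r) • A.
        have := H.moment_sub_smul k hi (hdeg A) (hdeg B) (-1)
        simp only [Pi.add_apply]
        rw [neg_one_mul, sub_neg_eq_add] at this
        rw [← this]
        congr! 5
        ext j
        simp
      map_smul' := fun r A => by
        ext k i
        have hi : ∀ j, n j + (i : ℕ) ≤ n j + m k := fun j => by omega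
        have := H.moment_sub_smul k hi (hdeg 0) (hdeg A) (-r)
        simp only [Pi.smul_apply, smul_eq_mul, RingHom.id_apply]
        have h0 : ∀ x, linearForm w₁ (fun j => (((0 : ∀ j, degreeLT ℝ (n j)) j : ℝ[X]))) x = 0 :=
          fun x => by simp [linearForm]
        simp only [h0, zero_mul, integral_zero, neg_mul, zero_sub, neg_neg] at this
        rw [← this]
        congr! 5
        ext j
        simp }
  have hinj : Function.Injective T := by
    rw [injective_iff_map_eq_zero]
    intro A hA
    have h := H.eq_zero _ (hdeg A) fun k i hi => congrFun (congrFun hA k) ⟨i, hi⟩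
    ext1 j
    exact Subtype.ext (congrFun h j)
  have hfr : Module.finrank ℝ (∀ j, degreeLT ℝ (n j)) =
      Module.finrank ℝ (∀ k, Fin (m k) → ℝ) := by
    rw [finrank_pi_degreeLT, Module.finrank_pi_fintype, H.card_eq]
    simp
  obtain ⟨A, hA⟩ := (LinearMap.injective_iff_surjective_of_finrank_eq_finrank hfr).1 hinj
    fun k i => c k i
  exact ⟨_, hdeg A, fun k i hi => congrFun (congrFun hA k) ⟨i, hi⟩⟩

lemma symm (H : Admissible w₁ w₂ n m) : Admissible w₂ w₁ m n where
  card_eq := H.card_eq.symm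
  integrable k j a ha := by
    simpa only [mul_comm (w₁ j _)] using H.integrable j k a (by omega)
  eq_zero B hB h := by
    -- With the coefficients of B as the moments of A, the pairing of the two forms is the sum of
    -- the squares of these coefficients; it vanishes by `h`, so B = 0.
    obtain ⟨A, hA, hAB⟩ := H.exists_moments fun k i => (B k).coeff i
    have hzero : ∫ x : ℝ, linearForm w₁ A x * linearForm w₂ B x = 0 := by
      have hint : ∀ j, ∀ s ∈ Finset.range (n j),
          Integrable fun x : ℝ => (A j).coeff s * (linearForm w₂ B x * x ^ s * w₁ j x) := by
        intro j s hs
        refine Integrable.const_mul ?_ _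
        have hs := Finset.mem_range.1 hs
        refine (H.integrable_mul (a := n) (b := m) (fun _ _ => Nat.le_succ _)
          (degree_single_X_pow_lt hs) hB).congr (.of_forall fun x => ?_)
        simp only [linearForm_single, eval_pow, eval_X]
        ring
      have hx : ∀ x, linearForm w₁ A x * linearForm w₂ B x = ∑ j, ∑ s ∈ Finset.range (n j),
          (A j).coeff s * (linearForm w₂ B x * x ^ s * w₁ j x) := fun x => by
        rw [linearForm_eq_sum w₁ hA, Finset.sum_mul]
        refine Finset.sum_congr rfl fun k _ => ?_
        rw [Finset.sum_mul]
        exact Finset.sum_congr rfl fun i _ => by ring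
      simp_rw [hx]
      rw [integral_finsetSum _ fun k _ => integrable_finsetSum _ (hint k)]
      refine Finset.sum_eq_zero fun j _ => ?_
      rw [integral_finsetSum _ (hint j)]
      refine Finset.sum_eq_zero fun s hs => ?_
      rw [integral_const_mul, h j s (Finset.mem_range.1 hs), mul_zero]
    rw [H.integral_mul_eq (fun j => Nat.le_succ _) hA hB,
      Finset.sum_eq_zero_iff_of_nonneg] at hzero
    · ext k i
      by_cases hi : i < m k
      · have h1 := hzero k (Finset.mem_univ k)
        rw [Finset.sum_eq_zero_iff_of_nonneg] at h1
        · have h2 := h1 i (Finset.mem_range.2 hi)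
          rw [hAB k i hi] at h2
          simpa using h2
        · intro i hi
          rw [hAB k i (Finset.mem_range.1 hi)]
          exact mul_self_nonneg _
      · simpa using coeff_eq_zero_of_degree_lt ((hB k).trans_le (by exact_mod_cast not_lt.1 hi))
    · intro k _
      refine Finset.sum_nonneg fun i hi => ?_
      rw [hAB k i (Finset.mem_range.1 hi)]
      exact mul_self_nonneg _

lemma integral_mul_eq' (H : Admissible w₁ w₂ n m) {A : Fin p → ℝ[X]} {B : Fin q → ℝ[X]}
    (hA : ∀ j, (A j).degree < n j) (hB : ∀ k, (B k).degree < m k) :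
    ∫ x : ℝ, linearForm w₁ A x * linearForm w₂ B x = ∑ j, ∑ s ∈ Finset.range (n j),
      (A j).coeff s * ∫ x : ℝ, linearForm w₂ B x * x ^ s * w₁ j x := by
  simp_rw [mul_comm (linearForm w₁ A _)]
  exact H.symm.integral_mul_eq (fun _ => Nat.le_succ _) hB hA

/-- Tuples in the range of admissible degrees are determined by their moments. -/
lemma eq_smul_of_moments (H : Admissible w₁ w₂ n m) {A B : Fin p → ℝ[X]}
    (hA : ∀ j, (A j).degree < n j) (hB : ∀ j, (B j).degree < n j) (c : ℝ)
    (h : ∀ k, ∀ i < m k, ∫ x : ℝ, linearForm w₁ A x * x ^ i * w₂ k x =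
      c * ∫ x : ℝ, linearForm w₁ B x * x ^ i * w₂ k x) : A = c • B := by
  refine sub_eq_zero.1 (H.eq_zero _ (degree_sub_smul_lt hA hB c) fun k i hi => ?_)
  rw [H.moment_sub_smul k (fun j => by omega) hA hB, h k i hi, sub_self]

end Admissible

/-! ### Shifted multi-indices; existence and uniqueness of type I and type II forms. -/

lemma sum_add_e (n : Fin p → ℕ) (j : Fin p) : ∑ l, (n + e j) l = (∑ l, n l) + 1 := by
  simp [Finset.sum_add_distrib, e]

lemma sub_e_add_e (j : Fin p) (hj : 0 < n j) : n - e j + e j = n := by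
  ext l
  by_cases h : l = j
  · subst h
    simp [e]
    omega
  · simp [e, Pi.single_eq_of_ne h]

lemma sub_e_self (n : Fin p → ℕ) (j : Fin p) : (n - e j) j = n j - 1 := by simp [e]

lemma sub_e_le (n : Fin p → ℕ) (j l : Fin p) : (n - e j) l ≤ n l := Nat.sub_le _ _

lemma lt_sub_e_or (j : Fin p) {l : Fin p} {i : ℕ} (hi : i < n l) :
    i < (n - e j) l ∨ l = j ∧ i = n j - 1 := by
  by_cases h : l = j
  · subst h
    rw [sub_e_self]
    omega
  · simp [e, Pi.single_eq_of_ne h, hi]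

lemma add_e_self (n : Fin p → ℕ) (j : Fin p) : (n + e j) j = n j + 1 := by simp [e]

lemma add_e_of_ne (n : Fin p → ℕ) {j l : Fin p} (h : l ≠ j) : (n + e j) l = n l := by
  simp [e, Pi.single_eq_of_ne h]

lemma add_e_le (n : Fin p → ℕ) (j l : Fin p) : (n + e j) l ≤ n l + 1 := by
  by_cases h : l = j
  · rw [h, add_e_self]
  · rw [add_e_of_ne n h]
    exact Nat.le_succ _

namespace Admissible

lemma exists_isTypeI (H : Admissible w₁ w₂ n m) (k : Fin q) (hk : 0 < m k) :
    ∃ A, IsTypeI w₁ w₂ n (m - e k) k A := by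
  -- Passing to `m - e k` drops exactly the condition of order m_k - 1 at k; that moment is
  -- prescribed as 1, the others as 0.
  obtain ⟨A, hA, hmA⟩ := H.exists_moments fun l i => if l = k ∧ i = m k - 1 then 1 else 0
  refine ⟨A, ⟨?_, hA, fun l i hi => H.integrable_moment l (fun j => ?_) hA, fun l i hi => ?_⟩, ?_⟩
  · rw [← sum_add_e, sub_e_add_e k hk, H.card_eq]
  · have := sub_e_le m k l
    omega
  · rw [hmA l i (hi.trans_le (sub_e_le m k l)), if_neg]
    rintro ⟨rfl, rfl⟩
    rw [sub_e_self] at hi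
    omega
  · rw [sub_e_self, hmA k _ (by omega), if_pos ⟨rfl, rfl⟩]

/-- All moments of B in the range of m vanish except the one dropped, so that single number
determines B. -/
lemma eq_smul_of_isTypeI (H : Admissible w₁ w₂ n m) (k : Fin q) {A B : Fin p → ℝ[X]}
    (hA : IsTypeI w₁ w₂ n (m - e k) k A) (hB : IsMixedMOP w₁ w₂ n (m - e k) B) :
    B = (∫ x : ℝ, linearForm w₁ B x * x ^ (m k - 1) * w₂ k x) • A := by
  refine H.eq_smul_of_moments hB.degree_lt hA.degree_lt _ fun l i hi => ?_
  obtain h | ⟨rfl, rfl⟩ := lt_sub_e_or k hi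
  · rw [hB.integral_eq_zero l i h, hA.integral_eq_zero l i h, mul_zero]
  · have := hA.integral_eq_one
    rw [sub_e_self] at this
    rw [this, mul_one]

lemma existsUnique_isTypeI (H : Admissible w₁ w₂ n m) (k : Fin q) (hk : 0 < m k) :
    ∃! A, IsTypeI w₁ w₂ n (m - e k) k A := by
  obtain ⟨A, hA⟩ := H.exists_isTypeI k hk
  refine ⟨A, hA, fun B hB => ?_⟩
  have h1 := hB.integral_eq_one
  rw [sub_e_self] at h1
  have h := H.eq_smul_of_isTypeI k hA hB.toIsMixedMOP
  rwa [h1, one_smul] at h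

lemma isNormalPair_sub_e (H : Admissible w₁ w₂ n m) (k : Fin q) (hk : 0 < m k) :
    IsNormalPair w₁ w₂ n (m - e k) := by
  obtain ⟨A, hA⟩ := H.exists_isTypeI k hk
  refine ⟨A, ?_, hA.toIsMixedMOP, fun B hB => ⟨_, H.eq_smul_of_isTypeI k hA hB⟩⟩
  rintro rfl
  simpa [linearForm] using hA.integral_eq_one

lemma isTypeI_polyI (H : Admissible w₁ w₂ n m) (k : Fin q) (hk : 0 < m k) :
    IsTypeI w₁ w₂ n (m - e k) k (polyI w₁ w₂ n (m - e k) k) := by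
  have h := H.exists_isTypeI k hk
  rw [polyI, dif_pos h]
  exact h.choose_spec

lemma exists_isTypeII (H : Admissible w₁ w₂ n m) (j : Fin p) :
    ∃ A, IsTypeII w₁ w₂ (n + e j) m j A := by
  have hX : ∀ l, ((Pi.single j (X ^ n j) : Fin p → ℝ[X]) l).degree < (n + e j) l :=
    degree_single_X_pow_lt (by simp [e])
  -- B corrects x^(n_j) w_j by an element of F with the same moments; the difference is orthogonal
  -- to G and still monic in component j.
  obtain ⟨B, hB, hmB⟩ := H.exists_moments fun k i =>
    ∫ x : ℝ, linearForm w₁ (Pi.single j (X ^ n j : ℝ[X])) x * x ^ i * w₂ k x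
  have hB' : ∀ l, (B l).degree < (n + e j) l := fun l =>
    (hB l).trans_le (by exact_mod_cast Nat.le_add_right _ _)
  have hle : ∀ k, ∀ i < m k, ∀ l, (n + e j) l + i ≤ n l + m k := fun k i hi l => by
    have := add_e_le n j l
    omega
  have hdeg := degree_sub_smul_lt hX hB' 1
  have hself : ((Pi.single j (X ^ n j) : Fin p → ℝ[X]) - (1 : ℝ) • B) j = X ^ n j - B j := by simp
  refine ⟨Pi.single j (X ^ n j : ℝ[X]) - (1 : ℝ) • B,
    ⟨by rw [sum_add_e, H.card_eq], hdeg, fun k i hi => H.integrable_moment k (hle k i hi) hdeg,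
      fun k i hi => ?_⟩, ?_, ?_⟩
  · rw [H.moment_sub_smul k (hle k i hi) hX hB', hmB k i hi, one_mul, sub_self]
  · rw [hself]
    exact monic_X_pow_sub (by simpa using hB j)
  · rw [hself, add_e_self, natDegree_eq_of_degree_eq_some (n := n j)]
    rw [degree_sub_eq_left_of_degree_lt (by simpa using hB j), degree_X_pow]

lemma coeff_eq_one_of_isTypeII {j : Fin p} {A : Fin p → ℝ[X]}
    (hA : IsTypeII w₁ w₂ (n + e j) m j A) : (A j).coeff (n j) = 1 := by
  have h := hA.natDegree_add_one
  rw [add_e_self] at h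
  rw [← Nat.succ_injective h]
  exact hA.monic

/-- Removing the coefficient of x^(n_j) in component j leaves a tuple with degrees below n and
vanishing moments, hence zero. -/
lemma eq_smul_of_isTypeII (H : Admissible w₁ w₂ n m) (j : Fin p) {A B : Fin p → ℝ[X]}
    (hA : IsTypeII w₁ w₂ (n + e j) m j A) (hB : IsMixedMOP w₁ w₂ (n + e j) m B) :
    B = (B j).coeff (n j) • A := by
  have hlc := coeff_eq_one_of_isTypeII hA
  have hdeg := degree_sub_smul_lt hB.degree_lt hA.degree_lt ((B j).coeff (n j))
  refine sub_eq_zero.1 (H.eq_zero _ (fun l => ?_) fun k i hi => ?_)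
  · by_cases h : l = j
    · subst h
      refine (degree_lt_iff_coeff_zero _ _).2 fun i hi => ?_
      obtain rfl | hi := hi.eq_or_lt
      · simp [hlc]
      · refine (degree_lt_iff_coeff_zero _ _).1 (hdeg l) i ?_
        rw [add_e_self]
        exact hi
    · simpa only [add_e_of_ne n h] using hdeg l
  · have hle : ∀ l, (n + e j) l + i ≤ n l + m k := fun l => by
      have := add_e_le n j l
      omega
    rw [H.moment_sub_smul k hle hB.degree_lt hA.degree_lt, hB.integral_eq_zero k i hi,
      hA.integral_eq_zero k i hi, mul_zero, sub_zero]

lemma existsUnique_isTypeII (H : Admissible w₁ w₂ n m) (j : Fin p) :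
    ∃! A, IsTypeII w₁ w₂ (n + e j) m j A := by
  obtain ⟨A, hA⟩ := H.exists_isTypeII j
  refine ⟨A, hA, fun B hB => ?_⟩
  have h := H.eq_smul_of_isTypeII j hA hB.toIsMixedMOP
  rwa [coeff_eq_one_of_isTypeII hB, one_smul] at h

lemma isNormalPair_add_e (H : Admissible w₁ w₂ n m) (j : Fin p) :
    IsNormalPair w₁ w₂ (n + e j) m := by
  obtain ⟨A, hA⟩ := H.exists_isTypeII j
  refine ⟨A, ?_, hA.toIsMixedMOP, fun B hB => ⟨_, H.eq_smul_of_isTypeII j hA hB⟩⟩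
  rintro rfl
  simpa using coeff_eq_one_of_isTypeII hA

lemma isTypeII_polyII (H : Admissible w₁ w₂ n m) (j : Fin p) :
    IsTypeII w₁ w₂ (n + e j) m j (polyII w₁ w₂ (n + e j) m j) := by
  have h := H.exists_isTypeII j
  rw [polyII, dif_pos h]
  exact h.choose_spec

lemma QI_mem (H : Admissible w₁ w₂ n m) (k : Fin q) (hk : 0 < m k) :
    QI w₁ w₂ n (m - e k) k ∈ formSpace w₁ n :=
  linearForm_mem w₁ (H.isTypeI_polyI k hk).degree_lt

/-- Pairing with the type I form extracts a leading coefficient. -/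
lemma integral_mul_QI (H : Admissible w₁ w₂ n m) (j : Fin p) (hj : 0 < n j) {A : Fin p → ℝ[X]}
    (hA : ∀ l, (A l).degree < n l) :
    ∫ x : ℝ, linearForm w₁ A x * QI w₂ w₁ m (n - e j) j x = (A j).coeff (n j - 1) := by
  have hI := H.symm.isTypeI_polyI j hj
  have h1 := hI.integral_eq_one
  rw [sub_e_self] at h1
  rw [QI, H.integral_mul_eq' hA hI.degree_lt, Finset.sum_eq_single j,
    Finset.sum_eq_single (n j - 1), h1, mul_one]
  · intro i hi hne
    rw [hI.integral_eq_zero, mul_zero]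
    rw [sub_e_self]
    have := Finset.mem_range.1 hi
    omega
  · intro h
    exact absurd (Finset.mem_range.2 (by omega)) h
  · intro l _ hl
    refine Finset.sum_eq_zero fun i hi => ?_
    obtain h | ⟨h, -⟩ := lt_sub_e_or j (Finset.mem_range.1 hi)
    · rw [hI.integral_eq_zero l i h, mul_zero]
    · exact absurd h hl
  · simp

lemma integrable_form_mul (H : Admissible w₁ w₂ n m) {f g : ℝ → ℝ} (hf : f ∈ formSpace w₁ n)
    (hg : g ∈ formSpace w₂ m) : Integrable fun x => f x * g x := by
  obtain ⟨A, hA, rfl⟩ := hf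
  obtain ⟨B, hB, rfl⟩ := hg
  exact H.integrable_mul (fun _ _ => Nat.le_succ _) hA hB

/-! ### Multiplication by x and the Christoffel–Darboux formula. -/

/-- Multiplication by the variable, modulo the type II forms, maps the space of forms to itself. -/
lemma exists_mul_X_eq (H : Admissible w₁ w₂ n m) (hn : ∀ j, 0 < n j) {f : ℝ → ℝ}
    (hf : f ∈ formSpace w₁ n) :
    ∃ f' ∈ formSpace w₁ n, (∀ x, x * f x = (∑ j, (∫ t, f t * QI w₂ w₁ m (n - e j) j t) *
        QII w₁ w₂ (n + e j) m j x) + f' x) ∧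
      ∀ g ∈ formSpace w₂ m, ∫ t, f' t * g t = ∫ t, t * f t * g t := by
  obtain ⟨A, hA, rfl⟩ := hf
  set P : Fin p → Fin p → ℝ[X] := fun j => polyII w₁ w₂ (n + e j) m j with hP
  have hII (j) : IsTypeII w₁ w₂ (n + e j) m j (P j) := H.isTypeII_polyII j
  set c : Fin p → ℝ := fun j => (A j).coeff (n j - 1) with hc
  have hform : ∀ x, linearForm w₁ ((fun l => X * A l) - ∑ j, c j • P j) x =
      x * linearForm w₁ A x - ∑ j, c j * linearForm w₁ (P j) x := fun x => by
    rw [← linearFormHom_apply, map_sub, map_sum]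
    simp only [map_smul, linearFormHom_apply, Pi.sub_apply, Finset.sum_apply, Pi.smul_apply,
      smul_eq_mul]
    congr 1
    simp [linearForm, Finset.mul_sum, mul_assoc]
  have hdeg : ∀ l, (((fun l => X * A l : Fin p → ℝ[X]) - ∑ j, c j • P j) l).degree < n l := by
    intro l
    refine (degree_lt_iff_coeff_zero _ _).2 fun i hi => ?_
    -- In component l only the l-th type II tuple reaches degree n_l, so it alone affects the
    -- coefficients checked here. Positivity of n_l makes the index a successor.
    obtain ⟨i, rfl⟩ : ∃ i', i = i' + 1 := ⟨i - 1, by have := hn l; omega⟩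
    simp only [Pi.sub_apply, Finset.sum_apply, Pi.smul_apply, coeff_sub, coeff_X_mul,
      finsetSum_coeff, coeff_smul, smul_eq_mul]
    rw [Finset.sum_eq_single l, sub_eq_zero]
    · obtain h | h := hi.eq_or_lt
      · rw [← h, coeff_eq_one_of_isTypeII (hII l), mul_one, hc]
        simp [h]
      · rw [(degree_lt_iff_coeff_zero _ _).1 (hA l) i (by omega),
          (degree_lt_iff_coeff_zero _ _).1 ((hII l).degree_lt l) (i + 1)
            (by rw [add_e_self]; omega), mul_zero]
    · intro j _ hj
      rw [(degree_lt_iff_coeff_zero _ _).1 ((hII j).degree_lt l) (i + 1)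
            (by rw [add_e_of_ne n hj.symm]; omega), mul_zero]
    · simp
  refine ⟨_, linearForm_mem w₁ hdeg, fun x => ?_, ?_⟩
  · simp_rw [fun j => H.integral_mul_QI j (hn j) hA, hform]
    simp [QII, hc, hP]
  · rintro _ ⟨B, hB, rfl⟩
    have hXA : ∀ l, (X * A l).degree < ((n l + 1 : ℕ) : WithBot ℕ) := fun l =>
      (degree_lt_iff_coeff_zero _ _).2 fun i hi => by
        obtain ⟨i, rfl⟩ : ∃ i', i = i' + 1 := ⟨i - 1, by omega⟩
        rw [coeff_X_mul, (degree_lt_iff_coeff_zero _ _).1 (hA l) i (by omega)]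
    have hint0 : Integrable fun t => t * linearForm w₁ A t * linearForm w₂ B t := by
      refine (H.integrable_mul (a := fun l => n l + 1) (b := m) (fun j k => by omega)
        hXA hB).congr (.of_forall fun t => ?_)
      simp [linearForm, Finset.mul_sum, mul_assoc]
    have hint : ∀ j ∈ Finset.univ,
        Integrable fun t => c j * (linearForm w₁ (P j) t * linearForm w₂ B t) := fun j _ =>
      (H.integrable_mul (fun l k => by have := add_e_le n j l; omega)
        (hII j).degree_lt hB).const_mul _
    have hzero : ∀ j, ∫ t, linearForm w₁ (P j) t * linearForm w₂ B t = 0 := fun j => by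
      rw [H.integral_mul_eq (add_e_le n j) (hII j).degree_lt hB]
      refine Finset.sum_eq_zero fun k _ => Finset.sum_eq_zero fun i hi => ?_
      rw [(hII j).integral_eq_zero k i (Finset.mem_range.1 hi), mul_zero]
    simp_rw [hform, sub_mul, Finset.sum_mul, mul_assoc (c _)]
    rw [integral_sub hint0 (integrable_finsetSum _ hint), integral_finsetSum _ hint]
    simp_rw [integral_const_mul, hzero]
    simp

end Admissible

/-- Pairing with ψ_i reads off the i-th coordinate in the basis φ. The identity is pointwise because
F consists of functions, not classes. -/
lemma Biorthogonal.eq_sum_left {N : ℕ} {F G : Submodule ℝ (ℝ → ℝ)}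
    {φ : Module.Basis (Fin N) ℝ F} {ψ : Module.Basis (Fin N) ℝ G} (h : Biorthogonal φ ψ)
    (hint : ∀ f ∈ F, ∀ g ∈ G, Integrable fun x => f x * g x) {f : ℝ → ℝ} (hf : f ∈ F) (x : ℝ) :
    f x = ∑ i, (∫ t, f t * (ψ i : ℝ → ℝ) t) * (φ i : ℝ → ℝ) x := by
  have hrepr : ∀ t, f t = ∑ i, φ.repr ⟨f, hf⟩ i * (φ i : ℝ → ℝ) t := fun t => by
    have := congrFun (congrArg Subtype.val (φ.sum_repr ⟨f, hf⟩)) t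
    rw [AddSubmonoidClass.coe_finsetSum, Finset.sum_apply] at this
    exact this.symm
  have hcoef : ∀ i, ∫ t, f t * (ψ i : ℝ → ℝ) t = φ.repr ⟨f, hf⟩ i := fun i => by
    simp_rw [hrepr, Finset.sum_mul, mul_assoc]
    rw [integral_finsetSum _ fun l _ =>
      (hint _ (φ l).2 _ (ψ i).2).const_mul _]
    simp_rw [integral_const_mul, h _ i]
    simp
  simp_rw [hcoef]
  exact hrepr x

lemma Biorthogonal.symm {N : ℕ} {F G : Submodule ℝ (ℝ → ℝ)}
    {φ : Module.Basis (Fin N) ℝ F} {ψ : Module.Basis (Fin N) ℝ G} (h : Biorthogonal φ ψ) :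
    Biorthogonal ψ φ := fun i j => by
  simp_rw [mul_comm ((ψ i : ℝ → ℝ) _), h j i, eq_comm]

namespace Admissible

/-- The Christoffel–Darboux formula. -/
theorem christoffel_darboux (H : Admissible w₁ w₂ n m) (hn : ∀ j, 0 < n j) (hm : ∀ k, 0 < m k)
    {N : ℕ} {φ : Module.Basis (Fin N) ℝ (formSpace w₁ n)}
    {ψ : Module.Basis (Fin N) ℝ (formSpace w₂ m)} (h : Biorthogonal φ ψ) (x y : ℝ) :
    (x - y) * kernel φ ψ x y =
      (∑ j, QII w₁ w₂ (n + e j) m j x * QI w₂ w₁ m (n - e j) j y) -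
      (∑ k, QI w₁ w₂ n (m - e k) k x * QII w₂ w₁ (m + e k) n k y) := by
  choose f hfF hf hfint using fun i => H.exists_mul_X_eq hn (φ i).2
  choose g hgG hg hgint using fun i => H.symm.exists_mul_X_eq hm (ψ i).2
  have hφ (u) (hu : u ∈ formSpace w₁ n) := h.eq_sum_left (fun _ h₁ _ h₂ =>
    H.integrable_form_mul h₁ h₂) hu
  have hψ (u) (hu : u ∈ formSpace w₂ m) := h.symm.eq_sum_left (fun _ h₁ _ h₂ =>
    H.symm.integrable_form_mul h₁ h₂) hu
  -- Both sides expand with the same matrix ∫ t φ_i ψ_l, since the remainders pair like x φ_i and y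
  -- ψ_i.
  have hswap : ∑ i, f i x * (ψ i : ℝ → ℝ) y = ∑ i, (φ i : ℝ → ℝ) x * g i y := by
    simp_rw [fun i => hφ _ (hfF i) x, fun i => hψ _ (hgG i) y, Finset.sum_mul, Finset.mul_sum]
    rw [Finset.sum_comm]
    refine Finset.sum_congr rfl fun i _ => Finset.sum_congr rfl fun l _ => ?_
    rw [hfint l _ (ψ i).2, hgint i _ (φ l).2]
    have ht : ∀ t, t * (φ l : ℝ → ℝ) t * (ψ i : ℝ → ℝ) t = t * (ψ i : ℝ → ℝ) t * (φ l : ℝ → ℝ) t :=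
      fun t => by ring
    simp_rw [ht]
    ring
  -- Expanding the type I forms in the basis ψ turns the sum over i of the coefficients into their
  -- values at y.
  have h1 : ∑ i, x * (φ i : ℝ → ℝ) x * (ψ i : ℝ → ℝ) y =
      (∑ j, QII w₁ w₂ (n + e j) m j x * QI w₂ w₁ m (n - e j) j y) +
        ∑ i, f i x * (ψ i : ℝ → ℝ) y := by
    simp_rw [hf, add_mul, Finset.sum_add_distrib, fun j => hψ _ (H.symm.QI_mem j (hn j)) y,
      Finset.sum_mul, Finset.mul_sum]
    congr 1
    rw [Finset.sum_comm]
    refine Finset.sum_congr rfl fun i _ => Finset.sum_congr rfl fun l _ => ?_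
    simp_rw [mul_comm (QI w₂ w₁ m (n - e i) i _)]
    ring
  have h2 : ∑ i, (φ i : ℝ → ℝ) x * (y * (ψ i : ℝ → ℝ) y) =
      (∑ k, QI w₁ w₂ n (m - e k) k x * QII w₂ w₁ (m + e k) n k y) +
        ∑ i, (φ i : ℝ → ℝ) x * g i y := by
    simp_rw [hg, mul_add, Finset.sum_add_distrib, fun k => hφ _ (H.QI_mem k (hm k)) x,
      Finset.sum_mul, Finset.mul_sum]
    congr 1
    rw [Finset.sum_comm]
    refine Finset.sum_congr rfl fun i _ => Finset.sum_congr rfl fun l _ => ?_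
    simp_rw [mul_comm (QI w₁ w₂ n (m - e i) i _)]
    ring
  rw [kernel, sub_mul, Finset.mul_sum, Finset.mul_sum, ← sub_eq_of_eq_add h1,
    ← sub_eq_of_eq_add h2, hswap, sub_sub_sub_cancel_right]
  congr 1 <;> exact Finset.sum_congr rfl fun i _ => by ring

/-! ### Dimensions and biorthogonal bases. -/

lemma nonempty_equiv_formSpace (H : Admissible w₁ w₂ n m) :
    Nonempty ((∀ j, degreeLT ℝ (n j)) ≃ₗ[ℝ] formSpace w₁ n) := by
  have hdeg (A : ∀ j, degreeLT ℝ (n j)) (j : Fin p) : (A j : ℝ[X]).degree < n j :=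
    mem_degreeLT.1 (A j).2
  let T : (∀ j, degreeLT ℝ (n j)) →ₗ[ℝ] formSpace w₁ n :=
    LinearMap.codRestrict (formSpace w₁ n)
      (linearFormHom w₁ ∘ₗ LinearMap.pi fun j => (degreeLT ℝ (n j)).subtype ∘ₗ LinearMap.proj j)
      fun A => ⟨_, hdeg A, rfl⟩
  have hinj : Function.Injective T := by
    rw [injective_iff_map_eq_zero]
    intro A hA
    have hA' : linearForm w₁ (fun j => (A j : ℝ[X])) = 0 := congrArg Subtype.val hA
    have h := H.eq_zero _ (hdeg A) fun k i hi => by simp [hA']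
    ext1 j
    exact Subtype.ext (congrFun h j)
  have hsurj : Function.Surjective T := by
    rintro ⟨_, A, hA, rfl⟩
    exact ⟨fun j => ⟨A j, mem_degreeLT.2 (hA j)⟩, rfl⟩
  exact ⟨LinearEquiv.ofBijective T ⟨hinj, hsurj⟩⟩

lemma finite_formSpace (H : Admissible w₁ w₂ n m) : Module.Finite ℝ (formSpace w₁ n) :=
  H.nonempty_equiv_formSpace.elim fun f => Module.Finite.equiv f

lemma finrank_formSpace (H : Admissible w₁ w₂ n m) :
    Module.finrank ℝ (formSpace w₁ n) = ∑ j, n j :=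
  H.nonempty_equiv_formSpace.elim fun f => by rw [← finrank_pi_degreeLT, f.finrank_eq]

lemma eq_zero_of_integral_mul (H : Admissible w₁ w₂ n m) {g : ℝ → ℝ} (hg : g ∈ formSpace w₂ m)
    (h : ∀ f ∈ formSpace w₁ n, ∫ x, f x * g x = 0) : g = 0 := by
  obtain ⟨B, hB, rfl⟩ := hg
  rw [H.symm.eq_zero B hB fun j s hs => ?_]
  · exact (linearFormHom w₂).map_zero
  · rw [← h _ (linearForm_mem w₁ (degree_single_X_pow_lt hs))]
    refine integral_congr_ae (.of_forall fun x => ?_)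
    simp only [linearForm_single, eval_pow, eval_X]
    ring

theorem exists_biorthogonal (H : Admissible w₁ w₂ n m) {N : ℕ} (hN : ∑ j, n j = N) :
    ∃ (φ : Module.Basis (Fin N) ℝ (formSpace w₁ n))
      (ψ : Module.Basis (Fin N) ℝ (formSpace w₂ m)), Biorthogonal φ ψ := by
  have := H.finite_formSpace
  have := H.symm.finite_formSpace
  let P : formSpace w₂ m →ₗ[ℝ] Module.Dual ℝ (formSpace w₁ n) := LinearMap.mk₂ ℝ
    (fun g f => ∫ x, (f : ℝ → ℝ) x * (g : ℝ → ℝ) x)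
    (fun g g' f => by
      rw [← integral_add (H.integrable_form_mul f.2 g.2) (H.integrable_form_mul f.2 g'.2)]
      simp [mul_add])
    (fun c g f => by
      rw [smul_eq_mul, ← integral_const_mul]
      simp [mul_left_comm])
    (fun g f f' => by
      rw [← integral_add (H.integrable_form_mul f.2 g.2) (H.integrable_form_mul f'.2 g.2)]
      simp [add_mul])
    (fun c g f => by
      rw [smul_eq_mul, ← integral_const_mul]
      simp [mul_assoc])
  have hinj : Function.Injective P := by
    rw [injective_iff_map_eq_zero]
    exact fun g hg => Subtype.ext
      (H.eq_zero_of_integral_mul g.2 fun f hf => LinearMap.congr_fun hg ⟨f, hf⟩)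
  have hsurj : Function.Surjective P := by
    refine (LinearMap.injective_iff_surjective_of_finrank_eq_finrank ?_).1 hinj
    rw [Subspace.dual_finrank_eq, H.finrank_formSpace, H.symm.finrank_formSpace, H.card_eq]
  let φ := Module.finBasisOfFinrankEq ℝ (formSpace w₁ n) (H.finrank_formSpace.trans hN)
  let E := LinearEquiv.ofBijective P ⟨hinj, hsurj⟩
  -- The pairing identifies G with the dual of F, so ψ is the dual basis of φ pulled back to G.
  refine ⟨φ, φ.dualBasis.map E.symm, fun i j => ?_⟩
  have h : P (E.symm (φ.dualBasis j)) = φ.dualBasis j := E.apply_symm_apply _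
  have h' := LinearMap.congr_fun h (φ i)
  rw [φ.dualBasis_apply_self] at h'
  exact h'

end Admissible

/-! ### From the L² hypotheses to admissibility. -/

lemma admissible_of_toL2 {N : ℕ} (hn : ∀ j, 0 < n j) (hm : ∀ k, 0 < m k)
    (hnN : ∑ j, n j = N) (hmN : ∑ k, m k = N)
    (hF : ∀ f ∈ formSpace w₁ n, MemLp f 2) (hG : ∀ g ∈ formSpace w₂ m, MemLp g 2)
    (hFdim : Module.finrank ℝ (toL2 (formSpace w₁ n)) = N)
    (hFG : toL2 (formSpace w₁ n) ⊓ (toL2 (formSpace w₂ m))ᗮ = ⊥)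
    (hmom : ∀ j k, Integrable (fun x : ℝ => x ^ (n j + m k - 1) * (w₁ j x * w₂ k x))) :
    Admissible w₁ w₂ n m := by
  have hdeg (A : ∀ j, degreeLT ℝ (n j)) (j : Fin p) : (A j : ℝ[X]).degree < n j :=
    mem_degreeLT.1 (A j).2
  have hprod : ∀ f ∈ formSpace w₁ n, ∀ g ∈ formSpace w₂ m, Integrable fun x => f x * g x :=
    fun f hf g hg => (hF f hf).integrable_mul (hG g hg)
  have hmono {j s} (hs : s < n j) {k i} (hi : i < m k) :
      Integrable fun x : ℝ => x ^ (s + i) * (w₁ j x * w₂ k x) := by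
    refine (hprod _ (linearForm_mem w₁ (degree_single_X_pow_lt hs)) _
      (linearForm_mem w₂ (degree_single_X_pow_lt hi))).congr (.of_forall fun x => ?_)
    simp only [linearForm_single, eval_pow, eval_X, pow_add]
    ring
  have hmem (A : ∀ j, degreeLT ℝ (n j)) : MemLp (linearForm w₁ fun j => (A j : ℝ[X])) 2 :=
    hF _ (linearForm_mem w₁ (hdeg A))
  let T : (∀ j, degreeLT ℝ (n j)) →ₗ[ℝ] toL2 (formSpace w₁ n) :=
    { toFun := fun A => ⟨(hmem A).toLp, _, linearForm_mem w₁ (hdeg A), MemLp.coeFn_toLp _⟩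
      map_add' := fun A B => Subtype.ext <|
        (MemLp.toLp_congr (hmem (A + B)) ((hmem A).add (hmem B)) (.of_forall fun x =>
          congrFun ((linearFormHom w₁).map_add (fun j => (A j : ℝ[X])) fun j => (B j : ℝ[X])) x)).trans
        (MemLp.toLp_add (hmem A) (hmem B))
      map_smul' := fun c A => Subtype.ext <|
        (MemLp.toLp_congr (hmem (c • A)) ((hmem A).const_smul c) (.of_forall fun x =>
          congrFun ((linearFormHom w₁).map_smul c fun j => (A j : ℝ[X])) x)).trans
        (MemLp.toLp_const_smul c (hmem A)) }
  have hsurj : Function.Surjective T := by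
    rintro ⟨u, f, ⟨A, hA, rfl⟩, hu⟩
    exact ⟨fun j => ⟨A j, mem_degreeLT.2 (hA j)⟩,
      Subtype.ext (Lp.ext ((MemLp.coeFn_toLp (hF _ (linearForm_mem w₁ hA))).trans hu.symm))⟩
  have : Module.Finite ℝ (toL2 (formSpace w₁ n)) := Module.Finite.of_surjective T hsurj
  -- The dimension N of the image equals that of the space of tuples, so a tuple is determined by
  -- its class in L².
  have hinj : Function.Injective T := by
    refine (LinearMap.injective_iff_surjective_of_finrank_eq_finrank ?_).2 hsurj
    rw [finrank_pi_degreeLT, hnN, hFdim]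
  refine ⟨hnN.trans hmN.symm, fun j k a ha => ?_, fun A hA h => ?_⟩
  · have := hn j
    have := hm k
    -- Exponents up to n_j + m_k - 2 split as s + i with s < n_j, i < m_k and come from products of
    -- L² functions; only the top one needs `hmom`.
    by_cases h1 : a < n j
    · simpa using hmono h1 (hm k)
    by_cases h2 : a = n j + m k - 1
    · exact h2 ▸ hmom j k
    · have h3 := hmono (j := j) (s := n j - 1) (by omega) (k := k) (i := a - (n j - 1)) (by omega)
      rwa [Nat.add_sub_cancel' (by omega)] at h3
  · let A' : ∀ j, degreeLT ℝ (n j) := fun j => ⟨A j, mem_degreeLT.2 (hA j)⟩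
    -- Vanishing moments say exactly that the class is orthogonal to G, so F ∩ G^⊥ = 0 kills it.
    have horth : ((T A' : toL2 (formSpace w₁ n)) : Lp ℝ 2 (volume : Measure ℝ)) ∈
        (toL2 (formSpace w₂ m))ᗮ := by
      rw [Submodule.mem_orthogonal]
      rintro v ⟨_, ⟨B, hB, rfl⟩, hv⟩
      have hu := MemLp.coeFn_toLp (hF _ (linearForm_mem w₁ hA))
      have hint : ∀ k, ∀ i ∈ Finset.range (m k), Integrable fun x : ℝ =>
          (B k).coeff i * (linearForm w₁ A x * x ^ i * w₂ k x) := fun k i hi => by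
        refine ((hprod _ (linearForm_mem w₁ hA) _ (linearForm_mem w₂ (degree_single_X_pow_lt
          (Finset.mem_range.1 hi)))).const_mul ((B k).coeff i)).congr (.of_forall fun x => ?_)
        simp only [linearForm_single, eval_pow, eval_X, mul_assoc]
      calc inner ℝ v _ = ∫ x, linearForm w₁ A x * linearForm w₂ B x := by
            rw [L2.inner_def]
            refine integral_congr_ae ?_
            filter_upwards [hu, hv] with x hx hx'
            rw [hx']
            exact congrArg (· * linearForm w₂ B x) hx
        _ = ∫ x, ∑ k, ∑ i ∈ Finset.range (m k),
              (B k).coeff i * (linearForm w₁ A x * x ^ i * w₂ k x) := by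
            refine integral_congr_ae (.of_forall fun x => ?_)
            simp only [linearForm_eq_sum w₂ hB, Finset.mul_sum]
            exact Finset.sum_congr rfl fun k _ => Finset.sum_congr rfl fun i _ => by ring
        _ = 0 := by
            rw [integral_finsetSum _ fun k _ => integrable_finsetSum _ (hint k)]
            refine Finset.sum_eq_zero fun k _ => ?_
            rw [integral_finsetSum _ (hint k)]
            refine Finset.sum_eq_zero fun i hi => ?_
            rw [integral_const_mul, h k i (Finset.mem_range.1 hi), mul_zero]
    have h0 : ((T A' : toL2 (formSpace w₁ n)) : Lp ℝ 2 (volume : Measure ℝ)) = 0 :=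
      (Submodule.mem_bot ℝ).1 (hFG ▸ Submodule.mem_inf.2 ⟨(T A').2, horth⟩)
    have h1 : A' = 0 := hinj (by rw [map_zero]; exact Subtype.ext h0)
    ext1 j
    exact congrArg Subtype.val (congrFun h1 j)

end MixedMOP

theorem corollary5p1 {p q N : ℕ} (w₁ : Fin p → ℝ → ℝ) (w₂ : Fin q → ℝ → ℝ)
    (hw₁ : ∀ j, MixedMOP.IsWeight (w₁ j)) (hw₂ : ∀ k, MixedMOP.IsWeight (w₂ k))
    (n : Fin p → ℕ) (m : Fin q → ℕ) (hn : ∀ j, 0 < n j) (hm : ∀ k, 0 < m k)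
    (hnN : ∑ j, n j = N) (hmN : ∑ k, m k = N)
    -- `F_n` and `G_m` are `N`-dimensional subspaces of `L²(ℝ)` with `F_n ∩ G_mᗮ = {0}`
    (hF : ∀ f ∈ MixedMOP.formSpace w₁ n, MemLp f 2)
    (hG : ∀ g ∈ MixedMOP.formSpace w₂ m, MemLp g 2)
    (hFdim : Module.finrank ℝ (MixedMOP.toL2 (MixedMOP.formSpace w₁ n)) = N)
    (hGdim : Module.finrank ℝ (MixedMOP.toL2 (MixedMOP.formSpace w₂ m)) = N)
    (hFG : MixedMOP.toL2 (MixedMOP.formSpace w₁ n) ⊓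
      (MixedMOP.toL2 (MixedMOP.formSpace w₂ m))ᗮ = ⊥)
    -- the highest moments in the orthogonality conditions converge
    (hmom : ∀ j k, Integrable (fun x : ℝ => x ^ (n j + m k - 1) * (w₁ j x * w₂ k x))) :
    -- the linear forms in the formula are well defined
    (∀ j, MixedMOP.IsNormalPair w₁ w₂ (n + MixedMOP.e j) m ∧
      ∃! A, MixedMOP.IsTypeII w₁ w₂ (n + MixedMOP.e j) m j A) ∧
    (∀ j, MixedMOP.IsNormalPair w₂ w₁ m (n - MixedMOP.e j) ∧
      ∃! A, MixedMOP.IsTypeI w₂ w₁ m (n - MixedMOP.e j) j A) ∧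
    (∀ k, MixedMOP.IsNormalPair w₁ w₂ n (m - MixedMOP.e k) ∧
      ∃! A, MixedMOP.IsTypeI w₁ w₂ n (m - MixedMOP.e k) k A) ∧
    (∀ k, MixedMOP.IsNormalPair w₂ w₁ (m + MixedMOP.e k) n ∧
      ∃! A, MixedMOP.IsTypeII w₂ w₁ (m + MixedMOP.e k) n k A) ∧
    -- biorthogonal bases exist
    (∃ (φ : Module.Basis (Fin N) ℝ (MixedMOP.formSpace w₁ n))
      (ψ : Module.Basis (Fin N) ℝ (MixedMOP.formSpace w₂ m)), MixedMOP.Biorthogonal φ ψ) ∧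
    -- the Christoffel–Darboux formula, for the kernel built from any biorthogonal bases
    (∀ (φ : Module.Basis (Fin N) ℝ (MixedMOP.formSpace w₁ n))
      (ψ : Module.Basis (Fin N) ℝ (MixedMOP.formSpace w₂ m)), MixedMOP.Biorthogonal φ ψ →
      ∀ x y : ℝ, (x - y) * MixedMOP.kernel φ ψ x y =
        (∑ j, MixedMOP.QII w₁ w₂ (n + MixedMOP.e j) m j x *
            MixedMOP.QI w₂ w₁ m (n - MixedMOP.e j) j y) -
        (∑ k, MixedMOP.QI w₁ w₂ n (m - MixedMOP.e k) k x *
            MixedMOP.QII w₂ w₁ (m + MixedMOP.e k) n k y)) := by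
  have H := MixedMOP.admissible_of_toL2 hn hm hnN hmN hF hG hFdim hFG hmom
  exact ⟨fun j => ⟨H.isNormalPair_add_e j, H.existsUnique_isTypeII j⟩,
    fun j => ⟨H.symm.isNormalPair_sub_e j (hn j), H.symm.existsUnique_isTypeI j (hn j)⟩,
    fun k => ⟨H.isNormalPair_sub_e k (hm k), H.existsUnique_isTypeI k (hm k)⟩,
    fun k => ⟨H.symm.isNormalPair_add_e k, H.symm.existsUnique_isTypeII k⟩,
    H.exists_biorthogonal hnN,
    fun φ ψ h x y => H.christoffel_darboux hn hm h x y⟩
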